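/- Let $d\ge 2$ be an integer, let $B=\{x\in\mathbb{R}^d:|x|\le 1\}$ be the unit ball and $\mathbb{S}^{d-1}$ the unit sphere of $\mathbb{R}^d$. Notation. For an integer $n\ge 1$ put $w_n=\pi^{n/2}/\Gamma(1+\tfrac n2)$ and $A_n=n\,w_n$. For $0\le z\le 1$ put $\Theta(z)=\int_0^{\arcsin z}\sin^{d-2}\theta\,\cos^2\theta\,d\theta$. Put $\sigma_2=1$ and $\sigma_d=\frac{d-1}{2}$ for $d\ge 3$. For a bounded Lebesgue measurable set $\Omega\subseteq\mathbb{R}^d$ with $|\Omega|>0$, let $$Per(\Omega)=\sup\Big\{\int_\Omega \mathrm{div}\,\varphi\,dx:\ \varphi\in C^1_c(\mathbb{R}^d,\mathbb{R}^d),\ \|\varphi\|_\infty\le 1\Big\},$$ $$V_u(\Omega)=\sup\Big\{\int_\Omega \langle\nabla\varphi,u\rangle\,dx:\ \varphi\in C^1_c(\mathbb{R}^d,\mathbb{R}),\ \|\varphi\|_\infty\le 1\Big\}\qquad(u\in\mathbb{S}^{d-1}),$$ $$g_\Omega(y)=|\Omega\cap(\Omega+y)|,\qquad \ell_\Omega=\inf\{\ell>0:\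 g_\Omega(y)=0\text{ for all }|y|\ge\ell\},$$ $$\gamma_\Omega(s)=\int_{\mathbb{S}^{d-1}}\Big(\frac{V_u(\Omega)}{2}-\frac{g_\Omega(0)-g_\Omega(su)}{s}\Big)\mathcal{H}^{d-1}(du)\qquad(s>0),$$ where $\mathcal{H}^{d-1}$ is the $(d-1)$-dimensional Hausdorff measure, normalized so that it is Lebesgue measure on $\mathbb{R}^{d-1}$. Let $\mathcal{W}$ be the class of all bounded Lebesgue measurable sets $\Omega\subseteq\mathbb{R}^d$ with $|\Omega|>0$ and $Per(\Omega)<\infty$ such that $s\mapsto\gamma_\Omega(\ell_\Omega s)$ is Lebesgue measurable on $(0,1)$ with $\int_0^1|\gamma_\Omega(\ell_\Omega s)|\,s^{-1}ds<\infty$. Theorem. One has $V_u(B)<\infty$ for all $u\in\mathbb{S}^{d-1}$; for every $0<s\le 1$ the integral defining $\gamma_B(2s)$ converges absolutely and $$\gamma_B(2s)=A_d\left(w_{d-1}\Big\{1-(1-s^2)^{\frac{d-1}{2}}\Big\}-A_{d-1}\,\frac{\Theta(1)-\Theta(\sqrt{1-s^2})}{s}\right).$$ As a result, the integral $\int_0^1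 s^{-1}\gamma_B(2s)\,ds$ converges absolutely, $$0\le\int_0^1 s^{-1}\gamma_B(2s)\,ds\le\frac{A_d\,w_{d-1}\,\sigma_d}{2},$$ and $B\in\mathcal{W}$. -/

import Mathlib

open MeasureTheory Metric
open scoped ENNReal MeasureTheory

noncomputable section

/-- `w_n = π^{n/2} / Γ(1 + n/2)`, the volume of the unit ball of `ℝⁿ`. -/
def ballVolume (n : ℕ) : ℝ := Real.pi ^ ((n : ℝ) / 2) / Real.Gamma (1 + (n : ℝ) / 2)

/-- `A_n = n w_n`, the surface area of the unit ball of `ℝⁿ`. -/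
def ballArea (n : ℕ) : ℝ := n * ballVolume n

/-- `Θ(z) = ∫_0^{arcsin z} sin^{d-2} θ cos² θ dθ` (used for `d ≥ 2` and `0 ≤ z ≤ 1`). -/
def Theta (d : ℕ) (z : ℝ) : ℝ :=
  ∫ θ in (0 : ℝ)..Real.arcsin z, Real.sin θ ^ (d - 2) * Real.cos θ ^ 2

/-- `σ_d`, equal to `1` for `d = 2` and to `(d - 1) / 2` for `d ≥ 3`. -/
def sigmaConst (d : ℕ) : ℝ := if d = 2 then 1 else ((d : ℝ) - 1) / 2

variable {d : ℕ}

/-- The divergence `∑ i, ∂φ_i/∂x_i` of a vector field on `ℝ^d`. -/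
def divergence (φ : EuclideanSpace ℝ (Fin d) → EuclideanSpace ℝ (Fin d))
    (x : EuclideanSpace ℝ (Fin d)) : ℝ :=
  ∑ i, (fderiv ℝ φ x (EuclideanSpace.single i 1)) i

/-- The perimeter
`Per(Ω) = sup { ∫_Ω div φ : φ ∈ C¹_c(ℝ^d, ℝ^d), ‖φ‖_∞ ≤ 1 }`, with value in `[0, ∞]`.
(The test field `φ = 0` shows that the supremum is nonnegative, so that truncating the
negative integrals to `0` does not change it.) -/
def perimeter (Ω : Set (EuclideanSpace ℝ (Fin d))) : ℝ≥0∞ :=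
  ⨆ φ ∈ {φ : EuclideanSpace ℝ (Fin d) → EuclideanSpace ℝ (Fin d) |
      ContDiff ℝ 1 φ ∧ HasCompactSupport φ ∧ ∀ x, ‖φ x‖ ≤ 1},
    ENNReal.ofReal (∫ x in Ω, divergence φ x)

/-- The directional variation of the indicator function of `Ω`,
`V_u(Ω) = sup { ∫_Ω ⟨∇φ, u⟩ : φ ∈ C¹_c(ℝ^d, ℝ), ‖φ‖_∞ ≤ 1 }`, with value in `[0, ∞]`. -/
def directionalVariation (Ω : Set (EuclideanSpace ℝ (Fin d)))
    (u : EuclideanSpace ℝ (Fin d)) : ℝ≥0∞ :=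
  ⨆ φ ∈ {φ : EuclideanSpace ℝ (Fin d) → ℝ |
      ContDiff ℝ 1 φ ∧ HasCompactSupport φ ∧ ∀ x, |φ x| ≤ 1},
    ENNReal.ofReal (∫ x in Ω, inner ℝ (gradient φ x) u)

/-- The set covariance function `g_Ω(y) = |Ω ∩ (Ω + y)|`. -/
def covarianceFn (Ω : Set (EuclideanSpace ℝ (Fin d))) (y : EuclideanSpace ℝ (Fin d)) : ℝ :=
  volume.real (Ω ∩ (fun x => x + y) '' Ω)

/-- `ℓ_Ω = inf { ℓ > 0 : g_Ω(y) = 0 for all |y| ≥ ℓ }`. -/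
def covarianceRadius (Ω : Set (EuclideanSpace ℝ (Fin d))) : ℝ :=
  sInf {l : ℝ | 0 < l ∧ ∀ y : EuclideanSpace ℝ (Fin d), l ≤ ‖y‖ → covarianceFn Ω y = 0}

/-- The integrand `V_u(Ω)/2 - (g_Ω(0) - g_Ω(su))/s`. -/
def gammaIntegrand (Ω : Set (EuclideanSpace ℝ (Fin d))) (s : ℝ)
    (u : EuclideanSpace ℝ (Fin d)) : ℝ :=
  (directionalVariation Ω u).toReal / 2 - (covarianceFn Ω 0 - covarianceFn Ω (s • u)) / s

/-- `γ_Ω(s) = ∫_{S^{d-1}} (V_u(Ω)/2 - (g_Ω(0) - g_Ω(su))/s) H^{d-1}(du)` for `s > 0`. Here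
`μHE[d - 1]` is the `(d-1)`-dimensional Hausdorff measure with the usual normalization,
in which it agrees with Lebesgue measure on `ℝ^{d-1}`. -/
def gammaFn (Ω : Set (EuclideanSpace ℝ (Fin d))) (s : ℝ) : ℝ :=
  ∫ u in sphere (0 : EuclideanSpace ℝ (Fin d)) 1, gammaIntegrand Ω s u ∂μHE[d - 1]

/-- The class `𝒲` of bounded Lebesgue measurable sets `Ω ⊆ ℝ^d` of finite perimeter for which
`s ↦ γ_Ω(ℓ_Ω s)` belongs to `L((0,1), s⁻¹ ds)`. The number `ℓ_Ω` is only meaningful for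
sets of positive measure, which is therefore part of the definition. -/
def classW (d : ℕ) : Set (Set (EuclideanSpace ℝ (Fin d))) :=
  {Ω | NullMeasurableSet Ω volume ∧ Bornology.IsBounded Ω ∧ 0 < volume Ω ∧
    perimeter Ω < ∞ ∧
    IntegrableOn (fun s : ℝ => s⁻¹ * gammaFn Ω (covarianceRadius Ω * s)) (Set.Ioo 0 1)}

/-- The closed unit ball of `ℝ^d`. -/
def unitBall (d : ℕ) : Set (EuclideanSpace ℝ (Fin d)) := closedBall 0 1

end

-- Write `d = n + 1` with `n ≥ 1`, and split space as `x = t u + z` with `z ⊥ u`. All ingredients of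
-- the integrand are then one-dimensional and independent of `u`. The chord of `B` over `z` has
-- endpoints `±√(1 - ‖z‖²)`, so integrating a gradient along chords gives `V_u(B) = 2 w_n`
-- (`directionalVariation_unitBall`). The lens `B ∩ (B + 2su)` has balls as slices, so `g_B(2su) = 2
-- w_n ∫_s^1 (1 - t²)^{n/2} dt` (`covarianceFn_unitBall`). Hence the integrand of `γ_B(2s)` is the
-- constant `w_n (1 - s⁻¹ ∫_0^s (1 - t²)^{n/2} dt)`, to be multiplied by the area of the sphere.
-- That area is taken for Hausdorff measure. It is found by comparing with the radial projection of
-- Lebesgue measure: both measures give small caps nearly the same mass, and double counting pairs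
-- of nearby points turns this into equality of total masses
-- (`euclideanHausdorffMeasure_real_sphere`). The substitution `t = cos θ` and an integration by
-- parts produce `Θ` (`Theta_one_sub_Theta`); the estimate `1 - (1 - t²)^{n/2} ≤ σ_d t²` gives the
-- bounds.

local notation "𝔼" n:max => EuclideanSpace ℝ (Fin n)

/-! ### Orthogonal coordinates adapted to a direction. -/

theorem exists_linearIsometryEquiv_prod {n : ℕ} (u : 𝔼 (n + 1)) (hu : ‖u‖ = 1) :
    ∃ T : WithLp 2 (ℝ × 𝔼 n) ≃ₗᵢ[ℝ] 𝔼 (n + 1), T (WithLp.toLp 2 (1, 0)) = u := by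
  have hu0 : u ≠ 0 := by rintro rfl; simp at hu
  have : Fact (Module.finrank ℝ (𝔼 (n + 1)) = n + 1) := ⟨by simp⟩
  let b := OrthonormalBasis.fromOrthogonalSpanSingleton (𝕜 := ℝ) n hu0
  let J : 𝔼 n →ₗᵢ[ℝ] 𝔼 (n + 1) :=
    (Submodule.subtypeₗᵢ (ℝ ∙ u)ᗮ).comp b.repr.symm.toLinearIsometry
  have hJ : ∀ z, inner ℝ u (J z) = 0 := fun z =>
    Submodule.mem_orthogonal_singleton_iff_inner_right.1 (b.repr.symm z).2
  let L : WithLp 2 (ℝ × 𝔼 n) →ₗ[ℝ] 𝔼 (n + 1) :=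
    { toFun := fun p => p.fst • u + J p.snd
      map_add' := fun p q => by simp [add_smul]; abel
      map_smul' := fun c p => by simp [mul_smul] }
  have hL : ∀ p, ‖L p‖ = ‖p‖ := fun p => by
    have h : ‖L p‖ ^ 2 = ‖p‖ ^ 2 := by
      change ‖p.fst • u + J p.snd‖ ^ 2 = _
      rw [WithLp.prod_norm_sq_eq_of_L2, norm_add_sq_real, inner_smul_left, hJ, norm_smul, hu,
        J.norm_map]
      simp
    exact (sq_eq_sq₀ (norm_nonneg _) (norm_nonneg _)).1 h
  have hfr : Module.finrank ℝ (WithLp 2 (ℝ × 𝔼 n)) = Module.finrank ℝ (𝔼 (n + 1)) := by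
    rw [(WithLp.linearEquiv 2 ℝ (ℝ × 𝔼 n)).finrank_eq]
    simp [add_comm]
  refine ⟨LinearIsometry.toLinearIsometryEquiv ⟨L, hL⟩ hfr, ?_⟩
  change (1 : ℝ) • u + J 0 = u
  simp

section Slicing

variable {n : ℕ} (T : WithLp 2 (ℝ × 𝔼 n) ≃ₗᵢ[ℝ] 𝔼 (n + 1))

/-- The measurable equivalence `ℝ × ℝⁿ ≃ ℝⁿ⁺¹` underlying a linear isometry. -/
noncomputable def slice : ℝ × 𝔼 n ≃ᵐ 𝔼 (n + 1) :=
  (MeasurableEquiv.toLp 2 (ℝ × 𝔼 n)).trans T.toHomeomorph.toMeasurableEquiv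

theorem slice_apply (p : ℝ × 𝔼 n) : slice T p = T (WithLp.toLp 2 p) := rfl

theorem measurePreserving_slice : MeasurePreserving (slice T) :=
  (WithLp.volume_preserving_toLp ℝ (𝔼 n)).trans T.measurePreserving

theorem norm_slice_sq (p : ℝ × 𝔼 n) : ‖slice T p‖ ^ 2 = p.1 ^ 2 + ‖p.2‖ ^ 2 := by
  rw [slice_apply, T.norm_map, WithLp.prod_norm_sq_eq_of_L2]
  simp

theorem slice_mem_closedBall_iff (p : ℝ × 𝔼 n) :
    slice T p ∈ closedBall (0 : 𝔼 (n + 1)) 1 ↔ p.1 ^ 2 + ‖p.2‖ ^ 2 ≤ 1 := by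
  rw [mem_closedBall_zero_iff, ← norm_slice_sq, sq_le_one_iff₀ (norm_nonneg _)]

theorem inner_slice {u : 𝔼 (n + 1)} (hT : T (WithLp.toLp 2 (1, 0)) = u) (p : ℝ × 𝔼 n) :
    inner ℝ (slice T p) u = p.1 := by
  rw [slice_apply, ← hT, T.inner_map_map, WithLp.prod_inner_apply]
  simp

theorem slice_add (p q : ℝ × 𝔼 n) : slice T (p + q) = slice T p + slice T q := by
  simp [slice_apply]

theorem slice_smul (c : ℝ) (p : ℝ × 𝔼 n) : slice T (c • p) = c • slice T p := by
  simp [slice_apply]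

theorem continuous_slice : Continuous (slice T) :=
  T.continuous.comp (WithLp.prod_continuous_toLp 2 ℝ (𝔼 n))

theorem volume_eq_lintegral_slice {s : Set (𝔼 (n + 1))} (hs : MeasurableSet s) :
    volume s = ∫⁻ t : ℝ, volume {z : 𝔼 n | slice T (t, z) ∈ s} := by
  rw [← (measurePreserving_slice T).measure_preimage_equiv s, Measure.volume_eq_prod,
    Measure.prod_apply ((slice T).measurable hs)]
  rfl

end Slicing

/-! ### Volumes of balls and Lipschitz images. -/

theorem ballVolume_pos (n : ℕ) : 0 < ballVolume n := by
  unfold ballVolume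
  have := Real.Gamma_pos_of_pos (show (0 : ℝ) < 1 + n / 2 by positivity)
  positivity

theorem volume_ball_euclidean {n : ℕ} (hn : n ≠ 0) {r : ℝ} (hr : 0 ≤ r) (x : 𝔼 n) :
    volume (ball x r) = ENNReal.ofReal (ballVolume n * r ^ n) := by
  have : Nonempty (Fin n) := ⟨⟨0, Nat.pos_of_ne_zero hn⟩⟩
  rw [EuclideanSpace.volume_ball, ← ENNReal.ofReal_pow hr, ← ENNReal.ofReal_mul (by positivity),
    Fintype.card_fin, mul_comm]
  congr 2
  rw [ballVolume, add_comm, Real.sqrt_eq_rpow, ← Real.rpow_natCast, ← Real.rpow_mul Real.pi_pos.le]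
  congr 2
  ring

theorem volume_closedBall_euclidean {n : ℕ} (hn : n ≠ 0) {r : ℝ} (hr : 0 ≤ r) (x : 𝔼 n) :
    volume (closedBall x r) = ENNReal.ofReal (ballVolume n * r ^ n) := by
  have : Nonempty (Fin n) := ⟨⟨0, Nat.pos_of_ne_zero hn⟩⟩
  rw [EuclideanSpace.volume_closedBall, ← EuclideanSpace.volume_ball (x := x), volume_ball_euclidean hn hr x]

theorem LipschitzOnWith.euclideanHausdorffMeasure_image_le {X Y : Type*}
    [EMetricSpace X] [MeasurableSpace X] [BorelSpace X]
    [EMetricSpace Y] [MeasurableSpace Y] [BorelSpace Y] {K : NNReal} {f : X → Y} {s : Set X}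
    (h : LipschitzOnWith K f s) (n : ℕ) : μHE[n] (f '' s) ≤ (K : ℝ≥0∞) ^ n * μHE[n] s := by
  have := h.hausdorffMeasure_image_le (Nat.cast_nonneg n)
  rw [ENNReal.rpow_natCast] at this
  simp only [Measure.euclideanHausdorffMeasure_def, Measure.smul_apply, ENNReal.smul_def,
    smul_eq_mul]
  rw [mul_left_comm]
  gcongr

/-! ### Masses of spherical caps for the cone measure and for Hausdorff measure. -/

section

variable {n : ℕ}

/-- The open half space `{x | c < ⟨x, u⟩}`. -/
def halfSpace (u : 𝔼 n) (c : ℝ) : Set (𝔼 n) := {x | c < inner ℝ x u}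

theorem isOpen_halfSpace (u : 𝔼 n) (c : ℝ) : IsOpen (halfSpace u c) :=
  isOpen_lt continuous_const (by fun_prop)

/-- The image of `n` times Lebesgue measure on the unit ball of `ℝⁿ` under radial projection to
the unit sphere. -/
noncomputable def coneMeasure (n : ℕ) : Measure (𝔼 n) :=
  ((n : ℝ≥0∞) • volume.restrict (ball 0 1)).map (fun x => ‖x‖⁻¹ • x)

theorem measurable_radialProj : Measurable (fun x : 𝔼 n => ‖x‖⁻¹ • x) := by fun_prop

theorem coneMeasure_apply {s : Set (𝔼 n)} (hs : MeasurableSet s) :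
    coneMeasure n s = n * volume ({x | ‖x‖⁻¹ • x ∈ s} ∩ ball 0 1) := by
  rw [coneMeasure, Measure.map_apply measurable_radialProj hs, Measure.smul_apply,
    Measure.restrict_apply (measurable_radialProj hs)]
  rfl

theorem coneMeasure_univ : coneMeasure n Set.univ = n * volume (ball (0 : 𝔼 n) 1) := by
  simp [coneMeasure_apply]

instance : IsFiniteMeasure (coneMeasure n) :=
  ⟨by rw [coneMeasure_univ]; exact ENNReal.mul_lt_top (by simp) measure_ball_lt_top⟩

theorem ae_coneMeasure_norm_eq_one (hn : n ≠ 0) : ∀ᵐ x ∂coneMeasure n, ‖x‖ = 1 := by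
  have : Nonempty (Fin n) := ⟨⟨0, Nat.pos_of_ne_zero hn⟩⟩
  refine (ae_map_iff measurable_radialProj.aemeasurable
    (measurableSet_eq_fun measurable_norm measurable_const)).2 ?_
  refine Measure.ae_smul_measure (ae_restrict_of_ae ?_) _
  filter_upwards [Measure.ae_ne volume (0 : 𝔼 n)] with x hx
  rw [norm_smul, norm_inv, norm_norm, inv_mul_cancel₀ (norm_ne_zero_iff.2 hx)]

theorem coneMeasure_halfSpace (u : 𝔼 n) {c : ℝ} (hc : 0 < c) :
    coneMeasure n (halfSpace u c) = n * volume ({x | c * ‖x‖ < inner ℝ x u} ∩ ball 0 1) := by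
  rw [coneMeasure_apply (isOpen_halfSpace u c).measurableSet]
  congr 3
  ext x
  simp only [halfSpace, Set.mem_ofPred_eq, real_inner_smul_left]
  rcases eq_or_ne x 0 with rfl | hx
  -- Since `0⁻¹ = 0`, the origin projects to `0`; as `c > 0`, it belongs to neither set.
  · simp [hc.le]
  · rw [← div_eq_inv_mul, lt_div_iff₀ (norm_pos_iff.2 hx)]

theorem lintegral_Ioo_mul_pow {a w : ℝ} (ha : 0 ≤ a) (hw : 0 ≤ w) :
    ∫⁻ t in Set.Ioo 0 a, ENNReal.ofReal (w * t ^ n) =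
      ENNReal.ofReal (w * a ^ (n + 1) / (n + 1)) := by
  rw [← ofReal_integral_eq_lintegral_ofReal, ← integral_Ioc_eq_integral_Ioo,
    ← intervalIntegral.integral_of_le ha, intervalIntegral.integral_const_mul, integral_pow]
  · simp [mul_div_assoc]
  · exact ((by fun_prop : Continuous fun t : ℝ => w * t ^ n).integrableOn_Icc).mono_set
      Set.Ioo_subset_Icc_self
  · refine (ae_restrict_iff' measurableSet_Ioo).2 (Filter.Eventually.of_forall fun t ht => ?_)
    have := ht.1.le
    simp only [Pi.zero_apply]
    positivity

theorem volume_cone_slices (hn : n ≠ 0) {a k : ℝ} (ha : 0 ≤ a) (hk : 0 ≤ k) :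
    volume {p : ℝ × 𝔼 n | p.1 ∈ Set.Ioo 0 a ∧ ‖p.2‖ < k * p.1} =
      ENNReal.ofReal (ballVolume n * k ^ n * a ^ (n + 1) / (n + 1)) := by
  have hm : MeasurableSet {p : ℝ × 𝔼 n | p.1 ∈ Set.Ioo 0 a ∧ ‖p.2‖ < k * p.1} :=
    (measurable_fst measurableSet_Ioo).inter
      (measurableSet_lt (f := fun p : ℝ × 𝔼 n => ‖p.2‖) (g := fun p => k * p.1) (by fun_prop)
        (by fun_prop))
  have hw := ballVolume_pos n
  rw [Measure.volume_eq_prod, Measure.prod_apply hm, ← lintegral_Ioo_mul_pow ha (by positivity),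
    ← lintegral_indicator measurableSet_Ioo]
  congr 1 with t
  by_cases ht : t ∈ Set.Ioo 0 a
  · have : Prod.mk t ⁻¹' {p : ℝ × 𝔼 n | p.1 ∈ Set.Ioo 0 a ∧ ‖p.2‖ < k * p.1} =
        ball 0 (k * t) := by
      ext z; simpa using fun _ => ht
    rw [this, volume_ball_euclidean hn (mul_nonneg hk ht.1.le), Set.indicator_of_mem ht, mul_pow,
      mul_assoc]
  · have : Prod.mk t ⁻¹' {p : ℝ × 𝔼 n | p.1 ∈ Set.Ioo 0 a ∧ ‖p.2‖ < k * p.1} = ∅ :=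
      Set.eq_empty_of_forall_notMem fun z hz => ht hz.1
    rw [Set.indicator_of_notMem ht, this, measure_empty]

variable {u : 𝔼 (n + 1)} (hn : n ≠ 0) (hu : ‖u‖ = 1) {c : ℝ} (hc : 0 < c) (hc1 : c < 1)
include hn hu hc hc1

/-- The set projecting into the cap is the cone `‖z‖ < (√(1 - c²)/c) t` cut by the unit ball. It is
squeezed between the truncations of this cone at heights `c` and `1`. -/
theorem coneMeasure_halfSpace_bounds :
    ENNReal.ofReal (ballVolume n * √(1 - c ^ 2) ^ n * c) ≤ coneMeasure (n + 1) (halfSpace u c) ∧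
      coneMeasure (n + 1) (halfSpace u c) ≤
        ENNReal.ofReal (ballVolume n * (√(1 - c ^ 2) / c) ^ n) := by
  obtain ⟨T, hT⟩ := exists_linearIsometryEquiv_prod u hu
  have hw := ballVolume_pos n
  have hs : √(1 - c ^ 2) ^ 2 = 1 - c ^ 2 := Real.sq_sqrt (by nlinarith)
  set s := √(1 - c ^ 2)
  have hs0 : 0 ≤ s := Real.sqrt_nonneg _
  have hk : 0 ≤ s / c := by positivity
  have hkc : c ^ 2 * (s / c) ^ 2 = 1 - c ^ 2 := by rw [← hs]; field_simp
  rw [coneMeasure_halfSpace u hc, ← (measurePreserving_slice T).measure_preimage_equiv]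
  have key : ∀ p : ℝ × 𝔼 n, p ∈ slice T ⁻¹' ({x | c * ‖x‖ < inner ℝ x u} ∩ ball 0 1) ↔
      (0 < p.1 ∧ ‖p.2‖ < s / c * p.1) ∧ p.1 ^ 2 + ‖p.2‖ ^ 2 < 1 := by
    intro p
    have h1 := norm_slice_sq T p
    simp only [Set.mem_preimage, Set.mem_inter_iff, Set.mem_ofPred_eq, inner_slice T hT,
      mem_ball_zero_iff]
    refine and_congr ⟨fun h => ?_, fun h => ?_⟩ ?_
    · have h0 : 0 < p.1 := lt_of_le_of_lt (by positivity) h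
      refine ⟨h0, lt_of_pow_lt_pow_left₀ 2 (by positivity) ?_⟩
      have h2 := pow_lt_pow_left₀ h (by positivity) two_ne_zero
      rw [mul_pow, h1] at h2
      rw [← mul_lt_mul_iff_right₀ (pow_pos hc 2), mul_pow, ← mul_assoc, hkc]
      linarith
    · refine lt_of_pow_lt_pow_left₀ 2 h.1.le ?_
      have h2 := pow_lt_pow_left₀ h.2 (by positivity) two_ne_zero
      rw [← mul_lt_mul_iff_right₀ (pow_pos hc 2), mul_pow, ← mul_assoc, hkc] at h2
      rw [mul_pow, h1]
      linarith
    · rw [← h1, sq_lt_one_iff₀ (norm_nonneg _)]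
  constructor
  · refine le_trans ?_ (mul_le_mul_right (measure_mono (s := {p : ℝ × 𝔼 n |
      p.1 ∈ Set.Ioo 0 c ∧ ‖p.2‖ < s / c * p.1}) ?_) _)
    · rw [volume_cone_slices hn hc.le hk, ← ENNReal.ofReal_natCast,
        ← ENNReal.ofReal_mul (by positivity)]
      refine (congrArg _ ?_).le
      push_cast
      rw [div_pow]
      field_simp
      ring
    -- On the cone, `t² + ‖z‖² < t²/c²`, which is below `1` when `t < c`.
    · rintro p ⟨⟨h0, h1⟩, h2⟩
      refine (key p).2 ⟨⟨h0, h2⟩, ?_⟩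
      have h3 := pow_lt_pow_left₀ h2 (by positivity) two_ne_zero
      have h4 := pow_lt_pow_left₀ h1 h0.le two_ne_zero
      rw [← mul_lt_mul_iff_right₀ (pow_pos hc 2), mul_pow, ← mul_assoc, hkc] at h3
      have : c ^ 2 * (p.1 ^ 2 + ‖p.2‖ ^ 2) < c ^ 2 * 1 := by linarith
      exact lt_of_mul_lt_mul_left this (by positivity)
  · refine (mul_le_mul_right (measure_mono (t := {p : ℝ × 𝔼 n |
      p.1 ∈ Set.Ioo 0 1 ∧ ‖p.2‖ < s / c * p.1}) ?_) _).trans ?_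
    · intro p hp
      obtain ⟨⟨h0, h1⟩, h2⟩ := (key p).1 hp
      exact ⟨⟨h0, by nlinarith [sq_nonneg ‖p.2‖]⟩, h1⟩
    · rw [volume_cone_slices hn zero_le_one hk, ← ENNReal.ofReal_natCast,
        ← ENNReal.ofReal_mul (by positivity)]
      refine (congrArg _ ?_).le
      push_cast
      rw [one_pow]
      field_simp

omit hn hu hc1 in
-- With `p`, `q` the two roots, `p² - q² = b² - a²`, while `p + q ≥ 2c` and `(a + b)² ≤ 4(1 - c²)`.
-- The constant is chosen so that adding `c² (a - b)²` leaves exactly `(a - b)²`, making the graph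
-- map of the cap `c⁻¹`-Lipschitz.
theorem sqrt_one_sub_sq_lipschitz {a b : ℝ}
    (ha1 : a ^ 2 ≤ 1 - c ^ 2) (hb1 : b ^ 2 ≤ 1 - c ^ 2) :
    c ^ 2 * (√(1 - a ^ 2) - √(1 - b ^ 2)) ^ 2 ≤ (1 - c ^ 2) * (a - b) ^ 2 := by
  have hp : c ≤ √(1 - a ^ 2) := Real.le_sqrt_of_sq_le (by linarith)
  have hq : c ≤ √(1 - b ^ 2) := Real.le_sqrt_of_sq_le (by linarith)
  have hp2 : √(1 - a ^ 2) ^ 2 = 1 - a ^ 2 := Real.sq_sqrt (by nlinarith)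
  have hq2 : √(1 - b ^ 2) ^ 2 = 1 - b ^ 2 := Real.sq_sqrt (by nlinarith)
  set p := √(1 - a ^ 2)
  set q := √(1 - b ^ 2)
  have h1 : (p - q) ^ 2 * (p + q) ^ 2 = (a - b) ^ 2 * (a + b) ^ 2 := by
    rw [← mul_pow, ← mul_pow, show (p - q) * (p + q) = -((a - b) * (a + b)) by nlinarith, neg_sq]
  have h2 : (2 * c) ^ 2 ≤ (p + q) ^ 2 := pow_le_pow_left₀ (by positivity) (by linarith) 2
  have h3 : (a + b) ^ 2 ≤ 4 * (1 - c ^ 2) := by nlinarith [sq_nonneg (a - b)]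
  have h4 := mul_le_mul_of_nonneg_left h2 (sq_nonneg (p - q))
  have h5 := mul_le_mul_of_nonneg_left h3 (sq_nonneg (a - b))
  linarith

/-- The cap is the graph of `√(1 - ‖z‖²)` over a ball of radius `√(1 - c²)`. Orthogonal projection
to the base is `1`-Lipschitz and the graph map is `c⁻¹`-Lipschitz. -/
theorem euclideanHausdorffMeasure_cap_bounds :
    ENNReal.ofReal (ballVolume n * √(1 - c ^ 2) ^ n) ≤
        μHE[n] (halfSpace u c ∩ sphere 0 1) ∧
      μHE[n] (halfSpace u c ∩ sphere 0 1) ≤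
        ENNReal.ofReal (ballVolume n * (√(1 - c ^ 2) / c) ^ n) := by
  obtain ⟨T, hT⟩ := exists_linearIsometryEquiv_prod u hu
  have hw := ballVolume_pos n
  have hs : √(1 - c ^ 2) ^ 2 = 1 - c ^ 2 := Real.sq_sqrt (by nlinarith)
  set s := √(1 - c ^ 2)
  have hs0 : 0 ≤ s := Real.sqrt_nonneg _
  have hball : ∀ z : 𝔼 n, z ∈ ball 0 s ↔ ‖z‖ ^ 2 < 1 - c ^ 2 := fun z => by
    rw [mem_ball_zero_iff, ← hs, sq_lt_sq₀ (norm_nonneg _) hs0]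
  let G : 𝔼 n → 𝔼 (n + 1) := fun z => slice T (√(1 - ‖z‖ ^ 2), z)
  have hG : halfSpace u c ∩ sphere 0 1 = G '' ball 0 s := by
    ext x
    obtain ⟨p, rfl⟩ := (slice T).surjective x
    have h1 := norm_slice_sq T p
    simp only [halfSpace, Set.mem_inter_iff, Set.mem_ofPred_eq, inner_slice T hT,
      mem_sphere_zero_iff_norm, Set.mem_image, hball]
    constructor
    · rintro ⟨h2, h3⟩
      rw [h3] at h1
      refine ⟨p.2, by nlinarith, ?_⟩
      simp only [G]
      congr 1
      ext1
      · rw [show 1 - ‖p.2‖ ^ 2 = p.1 ^ 2 by linarith, Real.sqrt_sq (by linarith)]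
      · rfl
    · rintro ⟨z, hz, hzp⟩
      have := (slice T).injective hzp
      subst this
      refine ⟨Real.lt_sqrt_of_sq_lt (by linarith), ?_⟩
      rw [Real.sq_sqrt (by nlinarith)] at h1
      have h2 : ‖slice T (√(1 - ‖z‖ ^ 2), z)‖ ^ 2 = 1 := by linarith
      exact (pow_eq_one_iff_of_nonneg (norm_nonneg _) two_ne_zero).1 h2
  have hvol : μHE[n] (ball (0 : 𝔼 n) s) = ENNReal.ofReal (ballVolume n * s ^ n) := by
    rw [EuclideanSpace.euclideanHausdorffMeasure_eq_volume, volume_ball_euclidean hn hs0]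
  rw [hG]
  constructor
  · let P : 𝔼 (n + 1) → 𝔼 n := fun x => ((slice T).symm x).2
    have hP : LipschitzOnWith 1 P (G '' ball 0 s) := by
      refine LipschitzOnWith.of_dist_le_mul fun x _ y _ => ?_
      obtain ⟨p, rfl⟩ := (slice T).surjective x
      obtain ⟨q, rfl⟩ := (slice T).surjective y
      simp only [P, MeasurableEquiv.symm_apply_apply, NNReal.coe_one, one_mul]
      have h1 := norm_slice_sq T (p - q)
      rw [sub_eq_add_neg, slice_add, ← neg_one_smul ℝ q, slice_smul, neg_one_smul, neg_one_smul,
        ← sub_eq_add_neg, ← sub_eq_add_neg] at h1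
      rw [dist_eq_norm, dist_eq_norm]
      refine (sq_le_sq₀ (norm_nonneg _) (norm_nonneg _)).1 ?_
      rw [h1]
      simp only [Prod.snd_sub]
      nlinarith [sq_nonneg (p - q).1]
    have h2 := hP.euclideanHausdorffMeasure_image_le n
    have h3 : P '' (G '' ball 0 s) = ball 0 s := by
      rw [Set.image_image]
      simp [P, G]
    rwa [h3, hvol, ENNReal.coe_one, one_pow, one_mul] at h2
  · have hL : LipschitzOnWith (c⁻¹).toNNReal G (ball 0 s) := by
      refine LipschitzOnWith.of_dist_le_mul fun z hz y hy => ?_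
      rw [hball] at hz hy
      have h1 := norm_slice_sq T ((√(1 - ‖z‖ ^ 2), z) - (√(1 - ‖y‖ ^ 2), y))
      rw [sub_eq_add_neg, slice_add, ← neg_one_smul ℝ (√(1 - ‖y‖ ^ 2), y), slice_smul,
        neg_one_smul, neg_one_smul, ← sub_eq_add_neg, ← sub_eq_add_neg] at h1
      simp only [Prod.fst_sub, Prod.snd_sub] at h1
      rw [dist_eq_norm, dist_eq_norm, Real.coe_toNNReal _ (by positivity), ← div_eq_inv_mul, le_div_iff₀ hc]
      refine (sq_le_sq₀ (by positivity) (norm_nonneg _)).1 ?_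
      have h2 := sqrt_one_sub_sq_lipschitz hc hz.le hy.le
      have h3 : (‖z‖ - ‖y‖) ^ 2 ≤ ‖z - y‖ ^ 2 := by
        rw [← sq_abs]
        exact pow_le_pow_left₀ (abs_nonneg _) (abs_norm_sub_norm_le z y) 2
      have h4 := mul_le_mul_of_nonneg_left h3 (by nlinarith : 0 ≤ 1 - c ^ 2)
      change (‖slice T _ - slice T _‖ * c) ^ 2 ≤ _
      rw [mul_pow, h1]
      linarith
    refine (hL.euclideanHausdorffMeasure_image_le n).trans ?_
    change ENNReal.ofReal c⁻¹ ^ n * _ ≤ _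
    rw [hvol, ← ENNReal.ofReal_pow (by positivity), ← ENNReal.ofReal_mul (by positivity)]
    refine (congrArg _ ?_).le
    rw [div_pow, inv_pow]
    field_simp

end

/-! ### The surface area of the sphere by double counting. -/

section SphereMeasure

variable {n : ℕ} (hn : n ≠ 0)
include hn

/-- Caps of finite measure cover a compact set. Finiteness is what permits Tonelli and cancellation
in real numbers below. -/
theorem euclideanHausdorffMeasure_sphere_lt_top :
    μHE[n] (sphere (0 : 𝔼 (n + 1)) 1) < ∞ := by
  refine (isCompact_sphere _ _).measure_lt_top_of_nhdsWithin fun x hx => ?_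
  have hx1 : ‖x‖ = 1 := by simpa using hx
  refine ⟨halfSpace x (1 / 2) ∩ sphere 0 1, ?_, lt_of_le_of_lt
    (euclideanHausdorffMeasure_cap_bounds hn hx1 one_half_pos one_half_lt_one).2
    ENNReal.ofReal_lt_top⟩
  refine Filter.inter_mem (mem_nhdsWithin_of_mem_nhds
    ((isOpen_halfSpace _ _).mem_nhds ?_)) self_mem_nhdsWithin
  simp only [halfSpace, Set.mem_ofPred_eq, real_inner_self_eq_norm_sq, hx1]
  norm_num

/-- The relation `c < ⟨x, u⟩` is symmetric, so both sides are the product measure of the same set of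
pairs. -/
theorem lintegral_coneMeasure_halfSpace (c : ℝ) :
    ∫⁻ u in sphere 0 1, coneMeasure (n + 1) (halfSpace u c) ∂μHE[n] =
      ∫⁻ x, μHE[n] (halfSpace x c ∩ sphere 0 1) ∂coneMeasure (n + 1) := by
  have : IsFiniteMeasure (μHE[n].restrict (sphere (0 : 𝔼 (n + 1)) 1)) :=
    ⟨by rw [Measure.restrict_apply_univ]; exact euclideanHausdorffMeasure_sphere_lt_top hn⟩
  have hm : MeasurableSet {p : 𝔼 (n + 1) × 𝔼 (n + 1) | c < inner ℝ p.2 p.1} :=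
    (isOpen_lt continuous_const (by fun_prop)).measurableSet
  have h1 := Measure.prod_apply (μ := μHE[n].restrict (sphere (0 : 𝔼 (n + 1)) 1))
    (ν := coneMeasure (n + 1)) hm
  rw [Measure.prod_apply_symm hm] at h1
  refine h1.symm.trans (lintegral_congr fun x => ?_)
  rw [Measure.restrict_apply (hm.preimage measurable_prodMk_right)]
  congr 2
  ext y
  simp [halfSpace, real_inner_comm]

/-- The cap bounds for the two measures are inserted into the double count; the common factor `w_n
√(1 - c²)^n` cancels, leaving only powers of `c`, which disappear as `c → 1`. -/
theorem euclideanHausdorffMeasure_sphere_bounds {c : ℝ} (hc : 0 < c) (hc1 : c < 1) :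
    c ^ (n + 1) * (μHE[n]).real (sphere (0 : 𝔼 (n + 1)) 1) ≤
        (coneMeasure (n + 1)).real Set.univ ∧
      c ^ n * (coneMeasure (n + 1)).real Set.univ ≤
        (μHE[n]).real (sphere (0 : 𝔼 (n + 1)) 1) := by
  have hs : 0 < √(1 - c ^ 2) := Real.sqrt_pos.2 (by nlinarith)
  have hw := ballVolume_pos n
  set s := √(1 - c ^ 2)
  have hswap := lintegral_coneMeasure_halfSpace hn c
  have hae : ∀ᵐ x ∂coneMeasure (n + 1), ‖x‖ = 1 := ae_coneMeasure_norm_eq_one n.succ_ne_zero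
  have hμ := (euclideanHausdorffMeasure_sphere_lt_top hn).ne
  have hσ := measure_ne_top (coneMeasure (n + 1)) Set.univ
  constructor
  · have h : ENNReal.ofReal (ballVolume n * s ^ n * c) * μHE[n] (sphere (0 : 𝔼 (n + 1)) 1) ≤
        ENNReal.ofReal (ballVolume n * (s / c) ^ n) * coneMeasure (n + 1) Set.univ := by
      calc _ = ∫⁻ u in sphere (0 : 𝔼 (n + 1)) 1, ENNReal.ofReal (ballVolume n * s ^ n * c)
              ∂μHE[n] := by rw [setLIntegral_const]
        _ ≤ ∫⁻ u in sphere 0 1, coneMeasure (n + 1) (halfSpace u c) ∂μHE[n] :=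
          setLIntegral_mono' isClosed_sphere.measurableSet fun u hu =>
            (coneMeasure_halfSpace_bounds hn (by simpa using hu) hc hc1).1
        _ = _ := hswap
        _ ≤ ∫⁻ x, ENNReal.ofReal (ballVolume n * (s / c) ^ n) ∂coneMeasure (n + 1) :=
          lintegral_mono_ae <| hae.mono fun x hx =>
            (euclideanHausdorffMeasure_cap_bounds hn hx hc hc1).2
        _ = _ := by rw [lintegral_const]
    have h2 := ENNReal.toReal_mono (ENNReal.mul_ne_top ENNReal.ofReal_ne_top hσ) h
    rw [ENNReal.toReal_mul, ENNReal.toReal_mul, ENNReal.toReal_ofReal (by positivity),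
      ENNReal.toReal_ofReal (by positivity)] at h2
    change _ * (μHE[n]).real _ ≤ _ * (coneMeasure (n + 1)).real _ at h2
    have h3 : 0 < ballVolume n * (s / c) ^ n := by positivity
    refine le_of_mul_le_mul_left (le_trans (le_of_eq ?_) h2) h3
    rw [div_pow]
    field_simp
    ring
  · have h : ENNReal.ofReal (ballVolume n * s ^ n) * coneMeasure (n + 1) Set.univ ≤
        ENNReal.ofReal (ballVolume n * (s / c) ^ n) * μHE[n] (sphere (0 : 𝔼 (n + 1)) 1) := by
      calc _ = ∫⁻ x, ENNReal.ofReal (ballVolume n * s ^ n) ∂coneMeasure (n + 1) := by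
            rw [lintegral_const]
        _ ≤ ∫⁻ x, μHE[n] (halfSpace x c ∩ sphere 0 1) ∂coneMeasure (n + 1) :=
          lintegral_mono_ae <| hae.mono fun x hx =>
            (euclideanHausdorffMeasure_cap_bounds hn hx hc hc1).1
        _ = _ := hswap.symm
        _ ≤ ∫⁻ u in sphere (0 : 𝔼 (n + 1)) 1, ENNReal.ofReal (ballVolume n * (s / c) ^ n)
              ∂μHE[n] :=
          setLIntegral_mono' isClosed_sphere.measurableSet fun u hu =>
            (coneMeasure_halfSpace_bounds hn (by simpa using hu) hc hc1).2
        _ = _ := by rw [setLIntegral_const]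
    have h2 := ENNReal.toReal_mono (ENNReal.mul_ne_top ENNReal.ofReal_ne_top hμ) h
    rw [ENNReal.toReal_mul, ENNReal.toReal_mul, ENNReal.toReal_ofReal (by positivity),
      ENNReal.toReal_ofReal (by positivity)] at h2
    change _ * (coneMeasure (n + 1)).real _ ≤ _ * (μHE[n]).real _ at h2
    have h3 : 0 < ballVolume n * (s / c) ^ n := by positivity
    refine le_of_mul_le_mul_left (le_trans (le_of_eq ?_) h2) h3
    rw [div_pow]
    field_simp

/-- The surface area of the unit sphere of `ℝⁿ⁺¹`. -/
theorem euclideanHausdorffMeasure_real_sphere :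
    (μHE[n]).real (sphere (0 : 𝔼 (n + 1)) 1) = ballArea (n + 1) := by
  have hσ : (coneMeasure (n + 1)).real Set.univ = ballArea (n + 1) := by
    rw [Measure.real, coneMeasure_univ, volume_ball_euclidean n.succ_ne_zero zero_le_one,
      ENNReal.toReal_mul, ENNReal.toReal_natCast,
      ENNReal.toReal_ofReal (by have := ballVolume_pos (n + 1); positivity), ballArea]
    simp
  have hlim : ∀ (m : ℕ) (a : ℝ), Filter.Tendsto (fun c : ℝ => c ^ m * a)
      (nhdsWithin 1 (Set.Iio 1)) (nhds a) := fun m a => by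
    have : Continuous fun c : ℝ => c ^ m * a := by fun_prop
    simpa using (this.tendsto 1).mono_left nhdsWithin_le_nhds
  have hev : ∀ᶠ c : ℝ in nhdsWithin 1 (Set.Iio 1), 0 < c ∧ c < 1 :=
    Ioo_mem_nhdsLT one_pos
  rw [← hσ]
  refine le_antisymm (le_of_tendsto (hlim (n + 1) _) ?_) (le_of_tendsto (hlim n _) ?_)
  · filter_upwards [hev] with c h using (euclideanHausdorffMeasure_sphere_bounds hn h.1 h.2).1
  · filter_upwards [hev] with c h using (euclideanHausdorffMeasure_sphere_bounds hn h.1 h.2).2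

end SphereMeasure

/-! ### Directional variation and perimeter of the ball. -/

theorem inner_gradient_eq_fderiv {n : ℕ} (φ : 𝔼 n → ℝ) (x u : 𝔼 n) :
    inner ℝ (gradient φ x) u = fderiv ℝ φ x u := by
  rw [← toDual_gradient, InnerProductSpace.toDual_apply_apply]

section

variable {n : ℕ} {T : WithLp 2 (ℝ × 𝔼 n) ≃ₗᵢ[ℝ] 𝔼 (n + 1)} {u : 𝔼 (n + 1)}

theorem hasDerivAt_slice (hT : T (WithLp.toLp 2 (1, 0)) = u) (z : 𝔼 n) (t : ℝ) :
    HasDerivAt (fun t : ℝ => slice T (t, z)) u t := by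
  have h : (fun t : ℝ => slice T (t, z)) = fun t : ℝ => t • u + slice T (0, z) := by
    funext t
    rw [← hT, ← slice_apply, ← slice_smul, ← slice_add]
    simp
  rw [h]
  simpa using ((hasDerivAt_id t).smul_const u).add_const (slice T (0, z))

theorem integral_fderiv_slice (hT : T (WithLp.toLp 2 (1, 0)) = u) {φ : 𝔼 (n + 1) → ℝ}
    (hφ : ContDiff ℝ 1 φ) (z : 𝔼 n) (a b : ℝ) :
    ∫ t in a..b, fderiv ℝ φ (slice T (t, z)) u = φ (slice T (b, z)) - φ (slice T (a, z)) := by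
  have hc : Continuous fun t : ℝ => fderiv ℝ φ (slice T (t, z)) u :=
    ((hφ.continuous_fderiv one_ne_zero).comp
      ((continuous_slice T).comp (by fun_prop : Continuous fun t : ℝ => (t, z)))).clm_apply
      continuous_const
  refine intervalIntegral.integral_eq_sub_of_hasDerivAt
    (f := fun t => φ (slice T (t, z))) (fun t _ => ?_) (hc.intervalIntegrable _ _)
  exact ((hφ.differentiable one_ne_zero (slice T (t, z))).hasFDerivAt).comp_hasDerivAt t
    (hasDerivAt_slice hT z t)

/-- Fubini along the chords parallel to `u`, with the fundamental theorem of calculus on each. -/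
theorem integral_ball_inner_gradient (hT : T (WithLp.toLp 2 (1, 0)) = u) {φ : 𝔼 (n + 1) → ℝ}
    (hφ : ContDiff ℝ 1 φ) :
    ∫ x in unitBall (n + 1), inner ℝ (gradient φ x) u =
      ∫ z in closedBall (0 : 𝔼 n) 1,
        (φ (slice T (√(1 - ‖z‖ ^ 2), z)) - φ (slice T (-√(1 - ‖z‖ ^ 2), z))) := by
  simp only [inner_gradient_eq_fderiv]
  have hc : Continuous fun x => fderiv ℝ φ x u :=
    (hφ.continuous_fderiv one_ne_zero).clm_apply continuous_const
  have hi : IntegrableOn (fun x => fderiv ℝ φ x u) (unitBall (n + 1)) :=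
    hc.continuousOn.integrableOn_compact (isCompact_closedBall _ _)
  have hem := (slice T).measurableEmbedding
  have hS : MeasurableSet (slice T ⁻¹' unitBall (n + 1)) :=
    (slice T).measurable measurableSet_closedBall
  rw [← (measurePreserving_slice T).setIntegral_preimage_emb hem]
  rw [← (measurePreserving_slice T).integrableOn_comp_preimage hem,
    ← integrable_indicator_iff hS, Function.comp_def] at hi
  rw [← integral_indicator hS, ← integral_indicator measurableSet_closedBall,
    Measure.volume_eq_prod, integral_prod_symm _ hi]
  congr 1 with z
  by_cases hz : z ∈ closedBall (0 : 𝔼 n) 1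
  · have hz1 : ‖z‖ ^ 2 ≤ 1 := by
      rw [mem_closedBall_zero_iff] at hz
      exact pow_le_one₀ (norm_nonneg _) hz
    have hq : 0 ≤ √(1 - ‖z‖ ^ 2) := Real.sqrt_nonneg _
    rw [Set.indicator_of_mem hz, ← integral_fderiv_slice hT hφ z,
      intervalIntegral.integral_of_le (by linarith), ← integral_Icc_eq_integral_Ioc,
      ← integral_indicator measurableSet_Icc]
    congr 1 with t
    have : (t, z) ∈ slice T ⁻¹' unitBall (n + 1) ↔
        t ∈ Set.Icc (-√(1 - ‖z‖ ^ 2)) (√(1 - ‖z‖ ^ 2)) := by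
      rw [Set.mem_preimage, unitBall, slice_mem_closedBall_iff, Set.mem_Icc, ← abs_le,
        ← sq_le_sq₀ (abs_nonneg t) hq, sq_abs, Real.sq_sqrt (by linarith)]
      constructor <;> intro h <;> simp only at h ⊢ <;> linarith
    by_cases ht : (t, z) ∈ slice T ⁻¹' unitBall (n + 1)
    · rw [Set.indicator_of_mem ht, Set.indicator_of_mem (this.1 ht)]
    · rw [Set.indicator_of_notMem ht, Set.indicator_of_notMem (mt this.2 ht)]
  · rw [Set.indicator_of_notMem hz]
    have : ∀ t : ℝ, (t, z) ∉ slice T ⁻¹' unitBall (n + 1) := fun t ht => by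
      rw [Set.mem_preimage, unitBall, slice_mem_closedBall_iff] at ht
      refine hz (mem_closedBall_zero_iff.2 ?_)
      rw [← sq_le_one_iff₀ (norm_nonneg _)]
      simp only at ht
      linarith [sq_nonneg t]
    simp [Set.indicator_of_notMem (this _)]

end

section

variable {n : ℕ} (hn : n ≠ 0)
include hn

theorem integral_ball_inner_gradient_le {u : 𝔼 (n + 1)} (hu : ‖u‖ = 1) {φ : 𝔼 (n + 1) → ℝ}
    (hφ : ContDiff ℝ 1 φ) (h1 : ∀ x, |φ x| ≤ 1) :
    ∫ x in unitBall (n + 1), inner ℝ (gradient φ x) u ≤ 2 * ballVolume n := by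
  obtain ⟨T, hT⟩ := exists_linearIsometryEquiv_prod u hu
  rw [integral_ball_inner_gradient hT hφ]
  refine (le_abs_self _).trans ?_
  have := norm_setIntegral_le_of_norm_le_const (μ := volume) (s := closedBall (0 : 𝔼 n) 1)
    (f := fun z => φ (slice T (√(1 - ‖z‖ ^ 2), z)) - φ (slice T (-√(1 - ‖z‖ ^ 2), z)))
    (C := 2) measure_closedBall_lt_top fun z _ => by
      rw [Real.norm_eq_abs]
      have h2 := abs_sub (φ (slice T (√(1 - ‖z‖ ^ 2), z))) (φ (slice T (-√(1 - ‖z‖ ^ 2), z)))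
      linarith [h1 (slice T (√(1 - ‖z‖ ^ 2), z)), h1 (slice T (-√(1 - ‖z‖ ^ 2), z))]
  rwa [Measure.real, volume_closedBall_euclidean hn zero_le_one, one_pow, mul_one,
    ENNReal.toReal_ofReal (ballVolume_pos n).le, Real.norm_eq_abs] at this

theorem exists_test_function {u : 𝔼 (n + 1)} (hu : ‖u‖ = 1) {r : ℝ} (hr : 0 < r) (hr1 : r < 1) :
    ∃ φ : 𝔼 (n + 1) → ℝ, (ContDiff ℝ 1 φ ∧ HasCompactSupport φ ∧ ∀ x, |φ x| ≤ 1) ∧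
      2 * ballVolume n * r ^ n ≤ ∫ x in unitBall (n + 1), inner ℝ (gradient φ x) u := by
  obtain ⟨T, hT⟩ := exists_linearIsometryEquiv_prod u hu
  have he : 0 < √(1 - r ^ 2) := Real.sqrt_pos.2 (by nlinarith)
  have he2 : √(1 - r ^ 2) ^ 2 = 1 - r ^ 2 := Real.sq_sqrt (by nlinarith)
  set ε := √(1 - r ^ 2)
  -- A smoothed sign, equal to `±1` outside `(-ε, ε)`. Chords over `‖z‖ ≤ r` end at height at least
  -- `ε = √(1 - r²)`, so they see the full jump `2`.
  let h : ℝ → ℝ := fun t => 2 * Real.smoothTransition ((t / ε + 1) / 2) - 1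
  have hh : ContDiff ℝ 1 h := by
    have : ContDiff ℝ 1 Real.smoothTransition := Real.smoothTransition.contDiff (n := 1)
    fun_prop
  have hmono : Monotone h := fun a b hab => by
    have : Real.smoothTransition ((a / ε + 1) / 2) ≤ Real.smoothTransition ((b / ε + 1) / 2) :=
      Real.smoothTransition.monotone (by gcongr)
    simp only [h]
    linarith
  have hone : ∀ t, ε ≤ t → h t = 1 := fun t ht => by
    have : 1 ≤ t / ε := (one_le_div he).2 ht
    simp only [h]
    rw [Real.smoothTransition.one_of_one_le (by linarith)]
    norm_num
  have hneg : ∀ t, t ≤ -ε → h t = -1 := fun t ht => by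
    have : t / ε ≤ -1 := (div_le_iff₀ he).2 (by linarith)
    simp only [h]
    rw [Real.smoothTransition.zero_of_nonpos (by linarith)]
    norm_num
  have habs : ∀ t, |h t| ≤ 1 := fun t => by
    have h1 := Real.smoothTransition.nonneg ((t / ε + 1) / 2)
    have h2 := Real.smoothTransition.le_one ((t / ε + 1) / 2)
    rw [abs_le]
    constructor <;> simp only [h] <;> linarith
  -- The cutoff equals `1` on the whole unit ball, so it supplies compact support without changing
  -- the integral.
  let χ : ContDiffBump (0 : 𝔼 (n + 1)) := ⟨1, 2, one_pos, one_lt_two⟩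
  have hφ : ContDiff ℝ 1 fun x : 𝔼 (n + 1) => h (inner ℝ x u) * χ x :=
    (hh.comp (contDiff_id.inner ℝ contDiff_const)).mul χ.contDiff
  refine ⟨fun x => h (inner ℝ x u) * χ x, ⟨hφ, χ.hasCompactSupport.mul_left, fun x => ?_⟩, ?_⟩
  · rw [abs_mul, abs_of_nonneg χ.nonneg]
    exact mul_le_one₀ (habs _) χ.nonneg χ.le_one
  · rw [integral_ball_inner_gradient hT hφ]
    have hval : ∀ z ∈ closedBall (0 : 𝔼 n) 1, ∀ t : ℝ, t ^ 2 = 1 - ‖z‖ ^ 2 →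
        h (inner ℝ (slice T (t, z)) u) * χ (slice T (t, z)) = h t := fun z hz t ht => by
      rw [inner_slice T hT, χ.one_of_mem_closedBall, mul_one]
      exact (slice_mem_closedBall_iff T _).2 (by simp only; linarith)
    have hle : ∀ z ∈ closedBall (0 : 𝔼 n) 1, ‖z‖ ^ 2 ≤ 1 := fun z hz =>
      pow_le_one₀ (norm_nonneg _) (mem_closedBall_zero_iff.1 hz)
    have hrw : ∫ z in closedBall (0 : 𝔼 n) 1,
        (h (inner ℝ (slice T (√(1 - ‖z‖ ^ 2), z)) u) * χ (slice T (√(1 - ‖z‖ ^ 2), z)) -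
          h (inner ℝ (slice T (-√(1 - ‖z‖ ^ 2), z)) u) * χ (slice T (-√(1 - ‖z‖ ^ 2), z))) =
        ∫ z in closedBall (0 : 𝔼 n) 1, (h (√(1 - ‖z‖ ^ 2)) - h (-√(1 - ‖z‖ ^ 2))) := by
      refine setIntegral_congr_fun measurableSet_closedBall fun z hz => ?_
      have := Real.sq_sqrt (show 0 ≤ 1 - ‖z‖ ^ 2 by linarith [hle z hz])
      rw [hval z hz _ this, hval z hz _ (by rw [neg_sq, this])]
    rw [hrw]
    have hcont : Continuous fun z : 𝔼 n => h (√(1 - ‖z‖ ^ 2)) - h (-√(1 - ‖z‖ ^ 2)) := by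
      have := hh.continuous
      fun_prop
    have hsub : closedBall (0 : 𝔼 n) r ⊆ closedBall 0 1 := closedBall_subset_closedBall hr1.le
    calc 2 * ballVolume n * r ^ n = ∫ z in closedBall (0 : 𝔼 n) r, (2 : ℝ) := by
          rw [setIntegral_const, Measure.real, volume_closedBall_euclidean hn hr.le,
            ENNReal.toReal_ofReal (by have := ballVolume_pos n; positivity), smul_eq_mul]
          ring
      _ = ∫ z in closedBall (0 : 𝔼 n) r, (h (√(1 - ‖z‖ ^ 2)) - h (-√(1 - ‖z‖ ^ 2))) := by
          refine setIntegral_congr_fun measurableSet_closedBall fun z hz => ?_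
          have h1 : ‖z‖ ^ 2 ≤ r ^ 2 :=
            pow_le_pow_left₀ (norm_nonneg _) (mem_closedBall_zero_iff.1 hz) 2
          have h2 : ε ≤ √(1 - ‖z‖ ^ 2) := Real.sqrt_le_sqrt (by linarith)
          rw [hone _ h2, hneg _ (neg_le_neg h2)]
          norm_num
      _ ≤ _ := by
          refine setIntegral_mono_set
            (hcont.continuousOn.integrableOn_compact (isCompact_closedBall _ _))
            (Filter.Eventually.of_forall fun z => ?_) hsub.eventuallyLE
          have := hmono (show -√(1 - ‖z‖ ^ 2) ≤ √(1 - ‖z‖ ^ 2) by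
            linarith [Real.sqrt_nonneg (1 - ‖z‖ ^ 2)])
          simp only [Pi.zero_apply]
          linarith

/-- The directional variation of the ball is twice the volume of its shadow. -/
theorem directionalVariation_unitBall {u : 𝔼 (n + 1)} (hu : ‖u‖ = 1) :
    directionalVariation (unitBall (n + 1)) u = ENNReal.ofReal (2 * ballVolume n) := by
  refine le_antisymm (iSup₂_le fun φ hφ => ENNReal.ofReal_le_ofReal
    (integral_ball_inner_gradient_le hn hu hφ.1 hφ.2.2)) ?_
  have hlim : Filter.Tendsto (fun r : ℝ => ENNReal.ofReal (2 * ballVolume n * r ^ n))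
      (nhdsWithin 1 (Set.Iio 1)) (nhds (ENNReal.ofReal (2 * ballVolume n))) := by
    have : Continuous fun r : ℝ => ENNReal.ofReal (2 * ballVolume n * r ^ n) :=
      ENNReal.continuous_ofReal.comp (by fun_prop)
    simpa using (this.tendsto 1).mono_left nhdsWithin_le_nhds
  refine le_of_tendsto hlim ?_
  have hev : ∀ᶠ c : ℝ in nhdsWithin 1 (Set.Iio 1), 0 < c ∧ c < 1 := Ioo_mem_nhdsLT one_pos
  filter_upwards [hev] with r hr
  obtain ⟨φ, hφ, h⟩ := exists_test_function hn hu hr.1 hr.2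
  exact (ENNReal.ofReal_le_ofReal h).trans
    (le_iSup₂ (f := fun (φ : 𝔼 (n + 1) → ℝ) (_ : φ ∈ {φ : 𝔼 (n + 1) → ℝ |
      ContDiff ℝ 1 φ ∧ HasCompactSupport φ ∧ ∀ x, |φ x| ≤ 1}) =>
      ENNReal.ofReal (∫ x in unitBall (n + 1), inner ℝ (gradient φ x) u)) φ hφ)

/-- Each component of a test field is bounded by `1`, so the divergence integral is at most the sum
of the variation bounds along the coordinate axes. -/
theorem perimeter_unitBall_lt_top : perimeter (unitBall (n + 1)) < ∞ := by
  refine lt_of_le_of_lt (iSup₂_le fun φ hφ => ENNReal.ofReal_le_ofReal (?_ : _ ≤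
    ∑ _i : Fin (n + 1), 2 * ballVolume n)) ENNReal.ofReal_lt_top
  obtain ⟨hφ, -, h1⟩ := hφ
  have hcomp : ∀ i, ContDiff ℝ 1 fun x => φ x i := fun i => by fun_prop
  have hd : ∀ x i, (fderiv ℝ φ x (EuclideanSpace.single i 1)) i =
      inner ℝ (gradient (fun x => φ x i) x) (EuclideanSpace.single i 1) := fun x i => by
    rw [inner_gradient_eq_fderiv]
    have h2 := (EuclideanSpace.proj i : 𝔼 (n + 1) →L[ℝ] ℝ).hasFDerivAt.comp x
      (hφ.differentiable one_ne_zero x).hasFDerivAt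
    have h3 : fderiv ℝ (fun x => φ x i) x = _ := h2.fderiv
    rw [h3]
    rfl
  simp only [divergence, hd]
  rw [integral_finsetSum]
  · refine Finset.sum_le_sum fun i _ =>
      integral_ball_inner_gradient_le hn (by simp) (hcomp i) fun x => ?_
    exact (PiLp.norm_apply_le (φ x) i).trans (h1 x)
  · intro i _
    simp only [inner_gradient_eq_fderiv]
    exact (((hcomp i).continuous_fderiv one_ne_zero).clm_apply
      continuous_const).continuousOn.integrableOn_compact (isCompact_closedBall _ _)

end

/-! ### The covariance function of the ball and `γ_B`. -/

section

variable {n : ℕ} (hn : n ≠ 0)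
include hn

theorem volume_setOf_norm_sq_le (a : ℝ) :
    volume {z : 𝔼 n | ‖z‖ ^ 2 ≤ a} = ENNReal.ofReal (ballVolume n * √a ^ n) := by
  rcases lt_or_ge a 0 with ha | ha
  · have : {z : 𝔼 n | ‖z‖ ^ 2 ≤ a} = ∅ :=
      Set.eq_empty_of_forall_notMem fun z (hz : ‖z‖ ^ 2 ≤ a) => by linarith [sq_nonneg ‖z‖]
    rw [this, Real.sqrt_eq_zero_of_nonpos ha.le, zero_pow hn]
    simp
  · have : {z : 𝔼 n | ‖z‖ ^ 2 ≤ a} = closedBall 0 √a := by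
      ext z
      rw [mem_closedBall_zero_iff, Real.le_sqrt (norm_nonneg _) ha]
      rfl
    rw [this, volume_closedBall_euclidean hn (Real.sqrt_nonneg _)]

/-- Recentred at its midpoint, the lens has at height `t` a ball of radius `√(1 - (|t| + s)²)` as
slice; evenness in `t` gives the factor `2`. Because the square root of a negative number is `0`,
integrating to infinity covers every `s ≥ 0`, disjoint balls included. -/
theorem covarianceFn_unitBall_eq_Ioi {u : 𝔼 (n + 1)} (hu : ‖u‖ = 1) {s : ℝ} (hs : 0 ≤ s) :
    covarianceFn (unitBall (n + 1)) ((2 * s) • u) =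
      2 * ∫ t in Set.Ioi s, ballVolume n * √(1 - t ^ 2) ^ n := by
  obtain ⟨T, hT⟩ := exists_linearIsometryEquiv_prod u hu
  have hw := ballVolume_pos n
  have hlens : volume (unitBall (n + 1) ∩ (fun x => x + (2 * s) • u) '' unitBall (n + 1)) =
      volume {x : 𝔼 (n + 1) | ‖x + s • u‖ ≤ 1 ∧ ‖x - s • u‖ ≤ 1} := by
    rw [← measure_preimage_add_right volume (s • u)]
    congr 1
    ext x
    simp only [unitBall, Set.image_add_right, Set.mem_preimage, Set.mem_inter_iff,
      mem_closedBall_zero_iff, Set.mem_ofPred_eq]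
    rw [show x + s • u + -((2 * s) • u) = x - s • u by rw [two_mul, add_smul]; abel]
  have hcl : IsClosed {x : 𝔼 (n + 1) | ‖x + s • u‖ ≤ 1 ∧ ‖x - s • u‖ ≤ 1} :=
    (isClosed_le (f := fun x : 𝔼 (n + 1) => ‖x + s • u‖) (by fun_prop) continuous_const).inter
      (isClosed_le (f := fun x : 𝔼 (n + 1) => ‖x - s • u‖) (by fun_prop) continuous_const)
  have hslice : ∀ t : ℝ, volume {z : 𝔼 n | slice T (t, z) ∈
      {x : 𝔼 (n + 1) | ‖x + s • u‖ ≤ 1 ∧ ‖x - s • u‖ ≤ 1}} =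
      ENNReal.ofReal (ballVolume n * √(1 - (|t| + s) ^ 2) ^ n) := fun t => by
    rw [← volume_setOf_norm_sq_le hn]
    congr 1
    ext z
    have hadd : ∀ a : ℝ, ‖slice T (t, z) + a • u‖ ≤ 1 ↔ ‖z‖ ^ 2 ≤ 1 - (t + a) ^ 2 := fun a => by
      rw [← hT, ← slice_apply, ← slice_smul, ← slice_add, ← sq_le_one_iff₀ (norm_nonneg _),
        norm_slice_sq]
      simp only [Prod.smul_mk, smul_zero, Prod.mk_add_mk, add_zero, smul_eq_mul, mul_one]
      constructor <;> intro h <;> linarith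
    simp only [Set.mem_ofPred_eq]
    rw [sub_eq_add_neg, ← neg_smul, hadd, hadd]
    have h0 : 0 ≤ |t| * s := by positivity
    have h1 := mul_le_mul_of_nonneg_right (le_abs_self t) hs
    have h2 := mul_le_mul_of_nonneg_right (neg_le_abs t) hs
    have h3 := sq_abs t
    -- The larger of `(t + s)²` and `(t - s)²` is `(|t| + s)²`.
    constructor
    · rintro ⟨ha, hb⟩
      rcases abs_cases t with ⟨h, -⟩ | ⟨h, -⟩ <;> rw [h] <;> nlinarith
    · intro h
      constructor <;> nlinarith
  have hcont : Continuous fun t : ℝ => ballVolume n * √(1 - (|t| + s) ^ 2) ^ n := by fun_prop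
  rw [covarianceFn, Measure.real, hlens, volume_eq_lintegral_slice T hcl.measurableSet]
  simp only [hslice]
  rw [← integral_eq_lintegral_of_nonneg_ae
    (Filter.Eventually.of_forall fun t => by simp only [Pi.zero_apply]; positivity)
    hcont.aestronglyMeasurable,
    integral_comp_abs (f := fun t => ballVolume n * √(1 - (t + s) ^ 2) ^ n),
    ← (measurePreserving_add_right volume s).setIntegral_preimage_emb
      (measurableEmbedding_addRight s) (fun t => ballVolume n * √(1 - t ^ 2) ^ n) (Set.Ioi s),
    Set.preimage_add_const_Ioi, sub_self]

theorem covarianceFn_unitBall {u : 𝔼 (n + 1)} (hu : ‖u‖ = 1) {s : ℝ} (hs : 0 ≤ s)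
    (hs1 : s ≤ 1) :
    covarianceFn (unitBall (n + 1)) ((2 * s) • u) =
      2 * ballVolume n * ∫ t in s..1, √(1 - t ^ 2) ^ n := by
  rw [covarianceFn_unitBall_eq_Ioi hn hu hs, integral_const_mul, ← mul_assoc,
    intervalIntegral.integral_of_le hs1]
  congr 1
  refine setIntegral_eq_of_subset_of_forall_sdiff_eq_zero measurableSet_Ioi
    Set.Ioc_subset_Ioi_self fun t ht => ?_
  have : 1 < t := by
    by_contra h
    exact ht.2 ⟨ht.1, not_lt.1 h⟩
  rw [Real.sqrt_eq_zero_of_nonpos (by nlinarith), zero_pow hn]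

theorem covarianceFn_unitBall_eq_zero {y : 𝔼 (n + 1)} (hy : 2 ≤ ‖y‖) :
    covarianceFn (unitBall (n + 1)) y = 0 := by
  have hy0 : ‖y‖ ≠ 0 := by linarith
  have h1 : ‖‖y‖⁻¹ • y‖ = 1 := by rw [norm_smul, norm_inv, norm_norm, inv_mul_cancel₀ hy0]
  have h := covarianceFn_unitBall_eq_Ioi hn h1 (s := ‖y‖ / 2) (by positivity)
  rw [mul_div_cancel₀ _ two_ne_zero, smul_inv_smul₀ hy0] at h
  rw [h, setIntegral_eq_zero_of_forall_eq_zero, mul_zero]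
  intro t ht
  have : 1 < t := lt_of_le_of_lt (by linarith) (Set.mem_Ioi.1 ht)
  rw [Real.sqrt_eq_zero_of_nonpos (by nlinarith), zero_pow hn, mul_zero]

theorem covarianceRadius_unitBall : covarianceRadius (unitBall (n + 1)) = 2 := by
  have h : {l : ℝ | 0 < l ∧ ∀ y : 𝔼 (n + 1), l ≤ ‖y‖ → covarianceFn (unitBall (n + 1)) y = 0} =
      Set.Ici 2 := by
    ext l
    simp only [Set.mem_ofPred_eq, Set.mem_Ici]
    refine ⟨fun ⟨hl, hy⟩ => ?_, fun hl => ⟨by linarith, fun y hy =>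
      covarianceFn_unitBall_eq_zero hn (hl.trans hy)⟩⟩
    by_contra! hl2
    have hu : ‖(EuclideanSpace.single 0 1 : 𝔼 (n + 1))‖ = 1 := by simp
    have h1 := covarianceFn_unitBall hn hu (s := l / 2) (by positivity) (by linarith)
    rw [mul_div_cancel₀ _ two_ne_zero, hy _ (by
      rw [norm_smul, hu, mul_one, Real.norm_of_nonneg hl.le])] at h1
    have hpos : 0 < ∫ t in (l / 2)..1, √(1 - t ^ 2) ^ n := by
      refine intervalIntegral.intervalIntegral_pos_of_pos_on
        (Continuous.intervalIntegrable (by fun_prop) _ _) (fun t ht => ?_) (by linarith)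
      have : 0 < t := lt_trans (by positivity) ht.1
      exact pow_pos (Real.sqrt_pos.2 (by nlinarith [ht.2])) n
    have := ballVolume_pos n
    have : 0 < 2 * ballVolume n * ∫ t in (l / 2)..1, √(1 - t ^ 2) ^ n := by positivity
    linarith
  rw [covarianceRadius, h, csInf_Ici]

theorem gammaIntegrand_unitBall {u : 𝔼 (n + 1)} (hu : ‖u‖ = 1) {s : ℝ} (hs : 0 < s)
    (hs1 : s ≤ 1) :
    gammaIntegrand (unitBall (n + 1)) (2 * s) u =
      ballVolume n * (1 - (∫ t in (0 : ℝ)..s, √(1 - t ^ 2) ^ n) / s) := by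
  have h0 := covarianceFn_unitBall hn hu le_rfl zero_le_one
  rw [mul_zero, zero_smul] at h0
  have hint : ∀ a b : ℝ, IntervalIntegrable (fun t : ℝ => √(1 - t ^ 2) ^ n) volume a b :=
    fun a b => Continuous.intervalIntegrable (by fun_prop) _ _
  rw [gammaIntegrand, h0, covarianceFn_unitBall hn hu hs.le hs1,
    directionalVariation_unitBall hn hu,
    ENNReal.toReal_ofReal (by have := ballVolume_pos n; positivity), ← mul_sub,
    ← intervalIntegral.integral_add_adjacent_intervals (hint 0 s) (hint s 1)]
  field_simp
  ring

theorem integrableOn_gammaIntegrand_unitBall {s : ℝ} (hs : 0 < s) (hs1 : s ≤ 1) :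
    IntegrableOn (gammaIntegrand (unitBall (n + 1)) (2 * s))
      (sphere (0 : 𝔼 (n + 1)) 1) μHE[n] :=
  (integrableOn_const (C := ballVolume n * (1 - (∫ t in (0 : ℝ)..s, √(1 - t ^ 2) ^ n) / s))
    (euclideanHausdorffMeasure_sphere_lt_top hn).ne).congr_fun
    (fun _ hu => (gammaIntegrand_unitBall hn (mem_sphere_zero_iff_norm.1 hu) hs hs1).symm)
    isClosed_sphere.measurableSet

theorem gammaFn_unitBall {s : ℝ} (hs : 0 < s) (hs1 : s ≤ 1) :
    gammaFn (unitBall (n + 1)) (2 * s) = ballArea (n + 1) *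
      (ballVolume n * (1 - (∫ t in (0 : ℝ)..s, √(1 - t ^ 2) ^ n) / s)) := by
  rw [gammaFn, Nat.add_sub_cancel, setIntegral_congr_fun isClosed_sphere.measurableSet
    (fun _ hu => gammaIntegrand_unitBall hn (mem_sphere_zero_iff_norm.1 hu) hs hs1),
    setIntegral_const, euclideanHausdorffMeasure_real_sphere hn, smul_eq_mul]

end

/-! ### The trigonometric formula and the bounds. -/

section

variable {n : ℕ} (hn : n ≠ 0)
include hn

theorem Theta_one_sub_Theta {s : ℝ} (hs : 0 ≤ s) (hs1 : s ≤ 1) :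
    n * (Theta (n + 1) 1 - Theta (n + 1) √(1 - s ^ 2)) =
      (∫ t in (0 : ℝ)..s, √(1 - t ^ 2) ^ n) - s * √(1 - s ^ 2) ^ n := by
  obtain ⟨m, rfl⟩ := Nat.exists_eq_add_one_of_ne_zero hn
  have hint : ∀ a b : ℝ, IntervalIntegrable
      (fun θ : ℝ => Real.sin θ ^ m * Real.cos θ ^ 2) volume a b :=
    fun a b => Continuous.intervalIntegrable (by fun_prop) _ _
  have hα : Real.arcsin √(1 - s ^ 2) = Real.arccos s :=
    (Real.arccos_eq_arcsin hs).symm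
  have hsin : Real.sin (Real.arccos s) = √(1 - s ^ 2) := Real.sin_arccos s
  have hcos : Real.cos (Real.arccos s) = s := Real.cos_arccos (by linarith) hs1
  set α := Real.arccos s
  have hαpi : α ≤ Real.pi / 2 := Real.arccos_le_pi_div_two.2 hs
  have hα0 : 0 ≤ α := Real.arccos_nonneg s
  have hTheta : Theta (m + 1 + 1) 1 - Theta (m + 1 + 1) √(1 - s ^ 2) =
      ∫ θ in α..(Real.pi / 2), Real.sin θ ^ m * Real.cos θ ^ 2 := by
    simp only [Theta, hα, Real.arcsin_one]
    exact intervalIntegral.integral_interval_sub_left (hint _ _) (hint _ _)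
  have hsub : ∫ t in (0 : ℝ)..s, √(1 - t ^ 2) ^ (m + 1) =
      ∫ θ in α..(Real.pi / 2), Real.sin θ ^ (m + 2) := by
    have h := intervalIntegral.integral_comp_mul_deriv (a := Real.pi / 2) (b := α)
      (f := Real.cos) (f' := fun θ => -Real.sin θ) (g := fun t => √(1 - t ^ 2) ^ (m + 1))
      (fun θ _ => Real.hasDerivAt_cos θ) (by fun_prop) (by fun_prop)
    rw [hcos, Real.cos_pi_div_two] at h
    rw [← h, intervalIntegral.integral_symm, ← intervalIntegral.integral_neg]
    refine intervalIntegral.integral_congr fun θ hθ => ?_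
    rw [Set.uIcc_of_le hαpi] at hθ
    have h0 : 0 ≤ Real.sin θ :=
      Real.sin_nonneg_of_nonneg_of_le_pi (hα0.trans hθ.1) (by linarith [hθ.2, Real.pi_pos])
    simp only [Function.comp_apply]
    rw [← Real.sin_sq, Real.sqrt_sq h0]
    ring
  -- The integrand is the derivative of `sin^(m+1) θ cos θ`, where `m = d - 2`.
  have hparts : ∫ θ in α..(Real.pi / 2),
      (((m + 1 : ℕ) : ℝ) * (Real.sin θ ^ m * Real.cos θ ^ 2) - Real.sin θ ^ (m + 2)) =
      0 - Real.sin α ^ (m + 1) * Real.cos α := by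
    rw [show (0 : ℝ) = Real.sin (Real.pi / 2) ^ (m + 1) * Real.cos (Real.pi / 2) by simp]
    refine intervalIntegral.integral_eq_sub_of_hasDerivAt
      (f := fun θ => Real.sin θ ^ (m + 1) * Real.cos θ) (fun θ _ => ?_)
      (Continuous.intervalIntegrable (by fun_prop) _ _)
    refine (((Real.hasDerivAt_sin θ).pow (m + 1)).mul (Real.hasDerivAt_cos θ)).congr_deriv ?_
    simp only [Nat.add_sub_cancel, Pi.pow_apply]
    ring
  rw [intervalIntegral.integral_sub ((hint _ _).const_mul _)
    (Continuous.intervalIntegrable (by fun_prop) _ _), intervalIntegral.integral_const_mul,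
    ← hTheta, ← hsub, hsin, hcos] at hparts
  linarith

/-- This is Bernoulli's inequality with exponent `n/2`, valid once `n ≥ 2`. For `n = 1` the exponent
is below `1`, and `√q ≥ q` on `[0, 1]` is used instead; hence the two cases of `σ_d`. -/
theorem one_sub_sqrt_pow_le {t : ℝ} (ht : t ^ 2 ≤ 1) :
    1 - √(1 - t ^ 2) ^ n ≤ sigmaConst (n + 1) * t ^ 2 := by
  have hq := Real.sq_sqrt (show 0 ≤ 1 - t ^ 2 by linarith)
  have hq0 := Real.sqrt_nonneg (1 - t ^ 2)
  have hq1 : √(1 - t ^ 2) ≤ 1 := Real.sqrt_le_one.2 (by linarith [sq_nonneg t])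
  rw [sigmaConst]
  split_ifs with h
  · obtain rfl : n = 1 := by omega
    nlinarith
  · have h2 : (1 : ℝ) ≤ n / 2 := by
      have : (2 : ℝ) ≤ n := by exact_mod_cast (by omega : 2 ≤ n)
      linarith
    have hb := one_add_mul_self_le_rpow_one_add (s := -t ^ 2) (by linarith) h2
    rw [Real.sqrt_eq_rpow, ← Real.rpow_natCast, ← Real.rpow_mul (by linarith),
      show (1 / 2 : ℝ) * n = n / 2 by ring, sub_eq_add_neg 1 (t ^ 2)]
    push_cast
    linarith

theorem average_sqrt_pow_bounds {s : ℝ} (hs : 0 < s) (hs1 : s ≤ 1) :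
    0 ≤ 1 - (∫ t in (0 : ℝ)..s, √(1 - t ^ 2) ^ n) / s ∧
      1 - (∫ t in (0 : ℝ)..s, √(1 - t ^ 2) ^ n) / s ≤ sigmaConst (n + 1) * s ^ 2 / 3 := by
  have hint : IntervalIntegrable (fun t : ℝ => √(1 - t ^ 2) ^ n) volume 0 s :=
    Continuous.intervalIntegrable (by fun_prop) _ _
  have heq : 1 - (∫ t in (0 : ℝ)..s, √(1 - t ^ 2) ^ n) / s =
      (∫ t in (0 : ℝ)..s, (1 - √(1 - t ^ 2) ^ n)) / s := by
    rw [intervalIntegral.integral_sub (by simp) hint, intervalIntegral.integral_const, smul_eq_mul,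
      mul_one, sub_zero, sub_div, div_self hs.ne']
  rw [heq]
  constructor
  · refine div_nonneg (intervalIntegral.integral_nonneg hs.le fun t ht => ?_) hs.le
    rw [sub_nonneg]
    exact pow_le_one₀ (Real.sqrt_nonneg _) (Real.sqrt_le_one.2 (by linarith [sq_nonneg t]))
  · rw [div_le_iff₀ hs]
    calc ∫ t in (0 : ℝ)..s, (1 - √(1 - t ^ 2) ^ n)
        ≤ ∫ t in (0 : ℝ)..s, sigmaConst (n + 1) * t ^ 2 := by
          refine intervalIntegral.integral_mono_on hs.le
            (Continuous.intervalIntegrable (by fun_prop) _ _)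
            (Continuous.intervalIntegrable (by fun_prop) _ _) fun t ht => ?_
          exact one_sub_sqrt_pow_le hn (by nlinarith [ht.1, ht.2])
      _ = sigmaConst (n + 1) * s ^ 2 / 3 * s := by
          rw [intervalIntegral.integral_const_mul, integral_pow]
          push_cast
          ring

theorem inv_mul_gammaFn_unitBall_bounds {s : ℝ} (hs : s ∈ Set.Ioo (0 : ℝ) 1) :
    0 ≤ s⁻¹ * gammaFn (unitBall (n + 1)) (2 * s) ∧
      s⁻¹ * gammaFn (unitBall (n + 1)) (2 * s) ≤
        ballArea (n + 1) * ballVolume n * sigmaConst (n + 1) / 2 := by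
  obtain ⟨h0, h1⟩ := average_sqrt_pow_bounds hn hs.1 hs.2.le
  have hw := ballVolume_pos n
  have hA : 0 < ballArea (n + 1) := by
    have := ballVolume_pos (n + 1)
    rw [ballArea]
    positivity
  have hσ : 0 ≤ sigmaConst (n + 1) := by
    rw [sigmaConst]
    split_ifs
    · exact zero_le_one
    · push_cast
      rw [add_sub_cancel_right]
      positivity
  have hs0 := hs.1
  rw [gammaFn_unitBall hn hs.1 hs.2.le]
  refine ⟨by positivity, ?_⟩
  -- One factor `s` absorbs `s⁻¹`, the other is bounded by `1`, and `1/3` is relaxed to `1/2`.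
  have h2 : s ^ 2 ≤ s := by nlinarith [hs.1, hs.2]
  have h3 := mul_le_mul_of_nonneg_left h2 hσ
  have h4 := mul_nonneg hσ hs0.le
  have h5 := mul_le_mul_of_nonneg_left
    (h1.trans (by linarith : _ ≤ s * sigmaConst (n + 1) / 2)) (mul_pos hA hw).le
  rw [inv_mul_le_iff₀ hs.1]
  linarith

/-- Measurability comes from the explicit formula, whose primitive is continuous in `s`;
integrability then follows from boundedness. -/
theorem integrableOn_inv_mul_gammaFn_unitBall :
    IntegrableOn (fun s : ℝ => s⁻¹ * gammaFn (unitBall (n + 1)) (2 * s)) (Set.Ioo 0 1) := by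
  have hcont : Continuous fun s : ℝ => ∫ t in (0 : ℝ)..s, √(1 - t ^ 2) ^ n :=
    intervalIntegral.continuous_primitive
      (fun a b => Continuous.intervalIntegrable (by fun_prop) _ _) 0
  have hmeas : Measurable fun s : ℝ => s⁻¹ * (ballArea (n + 1) *
      (ballVolume n * (1 - (∫ t in (0 : ℝ)..s, √(1 - t ^ 2) ^ n) / s))) := by
    have := hcont.measurable
    fun_prop
  have heq : ∀ s ∈ Set.Ioo (0 : ℝ) 1, s⁻¹ * (ballArea (n + 1) *
      (ballVolume n * (1 - (∫ t in (0 : ℝ)..s, √(1 - t ^ 2) ^ n) / s))) =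
      s⁻¹ * gammaFn (unitBall (n + 1)) (2 * s) := fun s hs => by
    rw [gammaFn_unitBall hn hs.1 hs.2.le]
  refine IntegrableOn.congr_fun (Measure.integrableOn_of_bounded
    (M := ballArea (n + 1) * ballVolume n * sigmaConst (n + 1) / 2) (by simp)
    hmeas.aestronglyMeasurable ?_) heq measurableSet_Ioo
  refine (ae_restrict_iff' measurableSet_Ioo).2 (Filter.Eventually.of_forall fun s hs => ?_)
  obtain ⟨h0, h1⟩ := inv_mul_gammaFn_unitBall_bounds hn hs
  rwa [heq s hs, Real.norm_of_nonneg h0]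

end

/-! ### The main theorem. -/

theorem mainTheorem2 (d : ℕ) (hd : 2 ≤ d) :
    -- all the quantities that enter `γ_B(2s)` are finite and the integral is meaningful
    (∀ u ∈ Metric.sphere (0 : EuclideanSpace ℝ (Fin d)) 1, directionalVariation (unitBall d) u < ∞) ∧
    (∀ s ∈ Set.Ioc (0 : ℝ) 1,
      IntegrableOn (gammaIntegrand (unitBall d) (2 * s))
        (Metric.sphere (0 : EuclideanSpace ℝ (Fin d)) 1) μHE[d - 1]) ∧
    -- the explicit formula
    (∀ s ∈ Set.Ioc (0 : ℝ) 1,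
      gammaFn (unitBall d) (2 * s) =
        ballArea d * (ballVolume (d - 1) * (1 - (1 - s ^ 2) ^ (((d : ℝ) - 1) / 2)) -
          ballArea (d - 1) * ((Theta d 1 - Theta d (Real.sqrt (1 - s ^ 2))) / s))) ∧
    -- the bounds for the (convergent) integral
    IntegrableOn (fun s : ℝ => s⁻¹ * gammaFn (unitBall d) (2 * s)) (Set.Ioo 0 1) ∧
    0 ≤ ∫ s in Set.Ioo (0 : ℝ) 1, s⁻¹ * gammaFn (unitBall d) (2 * s) ∧
    ∫ s in Set.Ioo (0 : ℝ) 1, s⁻¹ * gammaFn (unitBall d) (2 * s) ≤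
      ballArea d * ballVolume (d - 1) * sigmaConst d / 2 ∧
    -- membership in the class
    unitBall d ∈ classW d := by
  obtain ⟨n, rfl⟩ := Nat.exists_eq_add_of_le' (one_le_two.trans hd)
  have hn : n ≠ 0 := by omega
  have hbounds := fun s hs => inv_mul_gammaFn_unitBall_bounds hn (s := s) hs
  have hint := integrableOn_inv_mul_gammaFn_unitBall hn
  rw [Nat.add_sub_cancel]
  refine ⟨fun u hu => ?_, fun s hs => integrableOn_gammaIntegrand_unitBall hn hs.1 hs.2,
    fun s hs => ?_, hint, setIntegral_nonneg measurableSet_Ioo fun s hs => (hbounds s hs).1, ?_,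
    measurableSet_closedBall.nullMeasurableSet, isBounded_closedBall,
    measure_closedBall_pos volume 0 one_pos, perimeter_unitBall_lt_top hn, ?_⟩
  · rw [directionalVariation_unitBall hn (mem_sphere_zero_iff_norm.1 hu)]
    exact ENNReal.ofReal_lt_top
  · have hpow : (1 - s ^ 2) ^ ((((n + 1 : ℕ) : ℝ) - 1) / 2) = √(1 - s ^ 2) ^ n := by
      have : 0 ≤ 1 - s ^ 2 := by nlinarith [hs.1, hs.2]
      rw [Real.sqrt_eq_rpow, ← Real.rpow_natCast _ n, ← Real.rpow_mul this]
      push_cast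
      ring_nf
    have hΘ := Theta_one_sub_Theta hn hs.1.le hs.2
    have hs0 := hs.1.ne'
    rw [gammaFn_unitBall hn hs.1 hs.2, hpow, ballArea, ballArea,
      show n * ballVolume n * ((Theta (n + 1) 1 - Theta (n + 1) √(1 - s ^ 2)) / s) =
        ballVolume n * ((n * (Theta (n + 1) 1 - Theta (n + 1) √(1 - s ^ 2))) / s) by ring, hΘ]
    field_simp
    ring
  · refine (setIntegral_mono_on hint (integrableOn_const (by simp)) measurableSet_Ioo
      fun s hs => (hbounds s hs).2).trans ?_
    simp
  -- As `ℓ_B = 2`, the integrability condition of the class is the one already proved.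
  · rw [covarianceRadius_unitBall hn]
    exact hint
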